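/- Let $m \ge 0$, $[m]=\{1,\dots,m\}$, and let $L_1, L_2 \subseteq \mathbb{C}^m$ be linear subspaces, neither of which is contained in any coordinate hyperplane $\{x \in \mathbb{C}^m : x_e = 0\}$, $e \in [m]$. For $i=1,2$ and $F \subseteq [m]$ let $r_i(F)$ be the rank of $F$ in the linear matroid of $L_i$, i.e. the dimension of the span of the coordinate functions $x_e|_{L_i}$, $e \in F$, in the dual space $L_i^*$ (equivalently, the rank of the rows indexed by $F$ of a matrix whose columns form a basis of $L_i$). Let $L_1 * L_2 \subseteq \mathbb{C}^m$ be the Hadamard product, i.e. the Zariski closure of $\{(x_1y_1,\dots,x_my_m) : x \in L_1,\ y \in L_2\}$, which is an irreducible variety. For an irreducible variety $V \subseteq \mathbb{C}^m$, the algebraic matroid $\mathcal{M}(V)$ is the matroid on $[m]$ whose independent sets are the $E \subseteq [m]$ such that the coordinate projection $\pi_E(V)$ is Zariski dense in $\mathbb{C}^E$. For a set function $f \colon 2^{[m]} \to \mathbb{Z}$, the Dilworth truncation is $$f^{\mathrm D}(F) = \min\Big\{\textstyle\sum_{i=1}^t f(F_i) : \{F_1,\dots,F_t\} \text{ is a partition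 of } F \text{ into nonempty sets}\Big\},$$ with $f^{\mathrm D}(\emptyset)=0$. If $f$ is monotone, submodular and non-negative on nonempty sets, the matroid $\mathcal{M}_f$ induced by $f$ is the matroid on $[m]$ whose independent sets are the $F \subseteq [m]$ with $|I| \le f^{\mathrm D}(I)$ for all $I \subseteq F$. Then $$\mathcal{M}(L_1 * L_2) = \mathcal{M}_{r_1+r_2-1},$$ and the rank in this matroid of every nonempty $F \subseteq [m]$ is $$(r_1+r_2-1)^{\mathrm D}(F) = \min\Big\{\textstyle\sum_{i=1}^t \big(r_1(F_i)+r_2(F_i)-1\big) : \{F_1,\dots,F_t\} \text{ is a partition of } F \text{ into nonempty sets}\Big\}$$ (the rank of the empty set being $0$). -/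

import Mathlib

open scoped Finset

/-! ### Monotone submodular functions, Dilworth truncation, induced matroid -/

/-- `f` is a monotone submodular integer-valued set function.
No condition is put on the value at the empty set. -/
structure IsMonotoneSubmodular {m : ℕ} (f : Finset (Fin m) → ℤ) : Prop where
  mono : ∀ X Y, X ⊆ Y → f X ≤ f Y
  submodular : ∀ X Y, f (X ∪ Y) + f (X ∩ Y) ≤ f X + f Y

/-- The Dilworth truncation of `f`: the minimum of `∑ f (Fᵢ)` over all partitions
`{F₁, …, Fₜ}` of `F` into nonempty parts. The only partition of the empty set is the one
without parts, so the value at the empty set is `0`. -/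
def dilworthTruncation {m : ℕ} (f : Finset (Fin m) → ℤ) (F : Finset (Fin m)) : ℤ :=
  (Finset.univ : Finset (Finpartition F)).inf' Finset.univ_nonempty
    (fun P => ∑ p ∈ P.parts, f p)

theorem card_le_dilworthTruncation_iff {m : ℕ} (f : Finset (Fin m) → ℤ) (F : Finset (Fin m)) :
    (∀ I ⊆ F, (#I : ℤ) ≤ dilworthTruncation f I) ↔
      ∀ I ⊆ F, I.Nonempty → (#I : ℤ) ≤ f I := by
  constructor
  · intro h I hI hne
    refine (h I hI).trans ?_
    refine (Finset.inf'_le _ (Finset.mem_univ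
      (Finpartition.indiscrete (a := I) hne.ne_empty))).trans ?_
    simp
  · intro h I hI
    refine Finset.le_inf' _ _ fun P _ => ?_
    rw [← P.sum_card_parts]
    push_cast
    refine Finset.sum_le_sum fun p hp => h p ((P.le hp).trans hI) ?_
    exact P.nonempty_of_mem_parts hp

/-- The augmentation property behind the matroid induced by `f`. -/
theorem IsMonotoneSubmodular.augment {m : ℕ} {f : Finset (Fin m) → ℤ}
    (hf : IsMonotoneSubmodular f) (A B : Finset (Fin m))
    (hA : ∀ I ⊆ A, I.Nonempty → (#I : ℤ) ≤ f I)
    (hB : ∀ I ⊆ B, I.Nonempty → (#I : ℤ) ≤ f I) (hAB : #A < #B) :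
    ∃ b ∈ B, b ∉ A ∧ ∀ I ⊆ insert b A, I.Nonempty → (#I : ℤ) ≤ f I := by
  classical
  by_contra! hcon
  let Tight : Finset (Fin m) → Prop := fun T => T ⊆ A ∧ T.Nonempty ∧ f T ≤ #T
  have hunion : ∀ T U, Tight T → Tight U → (T ∩ U).Nonempty → Tight (T ∪ U) := by
    rintro T U ⟨hTA, hT, hfT⟩ ⟨hUA, hU, hfU⟩ hTU
    refine ⟨Finset.union_subset hTA hUA, hT.mono Finset.subset_union_left, ?_⟩
    have h1 := hf.submodular T U
    have h2 := hA (T ∩ U) (Finset.inter_subset_left.trans hTA) hTU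
    have h3 := Finset.card_union_add_card_inter T U
    omega
  have hstep : ∀ b ∈ B, b ∉ A → ∃ T, Tight T ∧ f (insert b T) ≤ #T := by
    intro b hb hbA
    obtain ⟨I, hI, hIne, hlt⟩ := hcon b hb hbA
    have hbI : b ∈ I := by
      by_contra hbI
      have : I ⊆ A := fun x hx => by
        rcases Finset.mem_insert.1 (hI hx) with rfl | h
        · exact absurd hx hbI
        · exact h
      have := hA I this hIne
      omega
    have h1 : (1 : ℤ) ≤ f I := by
      have h := hB {b} (by simpa using hb) (by simp)
      have h' := hf.mono {b} I (by simpa using hbI)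
      simp at h
      omega
    have hcard := Finset.card_erase_add_one hbI
    have hsub : I.erase b ⊆ A := by
      intro x hx
      obtain ⟨h1, h2⟩ := Finset.mem_erase.1 hx
      exact (Finset.mem_insert.1 (hI h2)).resolve_left h1
    refine ⟨I.erase b, ⟨hsub, ?_, ?_⟩, ?_⟩
    · rw [← Finset.card_pos]; omega
    · have := hf.mono _ _ (Finset.erase_subset b I)
      omega
    · rw [Finset.insert_erase hbI]; omega
  let D : Finset (Finset (Fin m)) :=
    A.powerset.filter fun T => Tight T ∧ ∀ U, Tight U → T ⊆ U → U = T
  have hmax : ∀ T, Tight T → ∃ U ∈ D, T ⊆ U := by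
    intro T hT
    obtain ⟨U, hTU, hU⟩ := Finset.exists_le_maximal (A.powerset.filter Tight)
      (a := T) (by simp [hT, hT.1])
    have hU1 : Tight U := (Finset.mem_filter.1 hU.1).2
    refine ⟨U, ?_, hTU⟩
    refine Finset.mem_filter.2 ⟨Finset.mem_powerset.2 hU1.1, hU1, fun W hW hUW => ?_⟩
    exact le_antisymm (hU.2 (Finset.mem_filter.2 ⟨Finset.mem_powerset.2 hW.1, hW⟩) hUW) hUW
  have hDT : ∀ U ∈ D, Tight U := fun U hU => (Finset.mem_filter.1 hU).2.1
  have hdisj : ∀ U ∈ D, ∀ W ∈ D, U ≠ W → Disjoint U W := by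
    intro U hU W hW hne
    rw [Finset.disjoint_iff_inter_eq_empty]
    by_contra h
    have ht := hunion U W (hDT U hU) (hDT W hW) (Finset.nonempty_iff_ne_empty.2 h)
    have e1 := (Finset.mem_filter.1 hU).2.2 _ ht Finset.subset_union_left
    have e2 := (Finset.mem_filter.1 hW).2.2 _ ht Finset.subset_union_right
    exact hne (e1.symm.trans e2)
  let S : Finset (Fin m) → Finset (Fin m) := fun U => (B \ A).filter fun b => f (insert b U) ≤ #U
  have hS : ∀ U ∈ D, f (U ∪ S U) ≤ #U := by
    intro U hU
    obtain ⟨hUA, hUne, hfU⟩ := hDT U hU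
    have key : ∀ S' : Finset (Fin m), S' ⊆ S U → f (U ∪ S') ≤ #U := by
      intro S'
      induction S' using Finset.induction_on with
      | empty => intro _; simpa using hfU
      | insert b S' hb ih =>
        intro hsub
        have h1 := ih ((Finset.subset_insert _ _).trans hsub)
        have h2 : f (insert b U) ≤ #U :=
          (Finset.mem_filter.1 (hsub (Finset.mem_insert_self b S'))).2
        have h3 := hf.submodular (U ∪ S') (insert b U)
        have h4 : U ∪ S' ∪ insert b U = U ∪ insert b S' := by
          ext x; simp; tauto
        have h5 : f U ≤ f ((U ∪ S') ∩ insert b U) := hf.mono _ _ (by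
          intro x hx; simp [hx])
        have h6 := hA U hUA hUne
        rw [h4] at h3
        omega
    exact key _ subset_rfl
  have hSB : ∀ U ∈ D, #(S U) ≤ #(U \ B) := by
    intro U hU
    obtain ⟨hUA, hUne, hfU⟩ := hDT U hU
    have hd : Disjoint (B ∩ U) (S U) := by
      rw [Finset.disjoint_left]
      intro x hx hx'
      exact (Finset.mem_sdiff.1 (Finset.mem_filter.1 hx').1).2 (hUA (Finset.mem_inter.1 hx).2)
    have h1 : #((B ∩ U) ∪ S U) ≤ #U := by
      rcases ((B ∩ U) ∪ S U).eq_empty_or_nonempty with h | h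
      · simp [h]
      · have h2 : (#((B ∩ U) ∪ S U) : ℤ) ≤ f ((B ∩ U) ∪ S U) := hB _ (Finset.union_subset Finset.inter_subset_left
          ((Finset.filter_subset _ _).trans Finset.sdiff_subset)) h
        have h3 := hf.mono _ _ (Finset.union_subset_union_left
          (t := S U) (Finset.inter_subset_right (s₁ := B) (s₂ := U)))
        have h4 := hS U hU
        omega
    rw [Finset.card_union_of_disjoint hd] at h1
    have h5 := Finset.card_sdiff_add_card_inter U B
    rw [Finset.inter_comm] at h5
    omega
  have hcover : B \ A ⊆ D.biUnion S := by
    intro b hb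
    obtain ⟨hbB, hbA⟩ := Finset.mem_sdiff.1 hb
    obtain ⟨T, hT, hbT⟩ := hstep b hbB hbA
    obtain ⟨U, hU, hTU⟩ := hmax T hT
    refine Finset.mem_biUnion.2 ⟨U, hU, Finset.mem_filter.2 ⟨hb, ?_⟩⟩
    obtain ⟨hUA, hUne, hfU⟩ := hDT U hU
    have h1 := hf.submodular (insert b T) U
    have h2 : insert b T ∪ U = insert b U := by
      rw [Finset.insert_union, Finset.union_eq_right.2 hTU]
    have h3 : f T ≤ f (insert b T ∩ U) := hf.mono _ _ (by
      intro x hx; simp [hx, hTU hx])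
    have h4 := hA T hT.1 hT.2.1
    rw [h2] at h1
    omega
  have hfinal : #(B \ A) ≤ #(A \ B) := by
    calc #(B \ A) ≤ #(D.biUnion S) := Finset.card_le_card hcover
      _ ≤ ∑ U ∈ D, #(S U) := Finset.card_biUnion_le
      _ ≤ ∑ U ∈ D, #(U \ B) := Finset.sum_le_sum hSB
      _ = #(D.biUnion fun U => U \ B) := by
        rw [Finset.card_biUnion]
        intro U hU W hW hne
        exact (hdisj U hU W hW hne).mono Finset.sdiff_subset Finset.sdiff_subset
      _ ≤ #(A \ B) := by
        refine Finset.card_le_card (Finset.biUnion_subset.2 fun U hU => ?_)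
        exact Finset.sdiff_subset_sdiff (hDT U hU).1 subset_rfl
  have e1 := Finset.card_sdiff_add_card_inter A B
  have e2 := Finset.card_sdiff_add_card_inter B A
  rw [Finset.inter_comm] at e2
  omega

/-- The matroid induced by a monotone submodular function `f`: a set is independent
iff each of its subsets `I` satisfies `|I| ≤ fᴰ(I)`, where `fᴰ` is the Dilworth truncation
of `f`. -/
def inducedMatroid {m : ℕ} (f : Finset (Fin m) → ℤ) (hf : IsMonotoneSubmodular f) :
    Matroid (Fin m) :=
  (IndepMatroid.ofFinset Set.univ
    (fun F : Finset (Fin m) => ∀ I ⊆ F, (#I : ℤ) ≤ dilworthTruncation f I)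
    (by
      rw [card_le_dilworthTruncation_iff]
      intro I hI hne
      exact absurd (Finset.subset_empty.1 hI) hne.ne_empty)
    (fun _ _ hJ hIJ K hK => hJ K (hK.trans hIJ))
    (by
      intro I J hI hJ hIJ
      simp only [card_le_dilworthTruncation_iff] at hI hJ ⊢
      exact hf.augment I J hI hJ hIJ)
    (fun _ _ => Set.subset_univ _)).matroid

theorem inducedMatroid_indep_iff {m : ℕ} (f : Finset (Fin m) → ℤ) (hf : IsMonotoneSubmodular f)
    (F : Finset (Fin m)) :
    (inducedMatroid f hf).Indep (F : Set (Fin m)) ↔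
      ∀ I ⊆ F, (#I : ℤ) ≤ dilworthTruncation f I := by
  unfold inducedMatroid
  rw [IndepMatroid.matroid_indep_iff, IndepMatroid.ofFinset_indep]

/-! ### Varieties and algebraic matroids -/

/-- The closure of `S` in the Zariski topology on affine space `ℂ^σ`. -/
def zariskiClosure {σ : Type*} (S : Set (σ → ℂ)) : Set (σ → ℂ) :=
  MvPolynomial.zeroLocus ℂ (MvPolynomial.vanishingIdeal ℂ S)

/-- An irreducible affine variety in `ℂ^σ`: a Zariski closed set whose ideal is prime. -/
structure IsIrreducibleVariety {σ : Type*} (V : Set (σ → ℂ)) : Prop where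
  closed : zariskiClosure V = V
  prime : (MvPolynomial.vanishingIdeal ℂ V).IsPrime

theorem vanishingIdeal_zariskiClosure {σ : Type*} (S : Set (σ → ℂ)) :
    MvPolynomial.vanishingIdeal ℂ (zariskiClosure S) = MvPolynomial.vanishingIdeal ℂ S :=
  le_antisymm
    (MvPolynomial.vanishingIdeal_anti_mono (MvPolynomial.zeroLocus_vanishingIdeal_le S))
    (MvPolynomial.le_vanishingIdeal_zeroLocus _)

theorem zariskiClosure_eq_univ_iff {σ : Type*} (S : Set (σ → ℂ)) :
    zariskiClosure S = Set.univ ↔ MvPolynomial.vanishingIdeal ℂ S = ⊥ := by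
  constructor
  · intro h
    rw [← vanishingIdeal_zariskiClosure, h, eq_bot_iff]
    intro p hp
    refine MvPolynomial.funext fun x => ?_
    simpa [MvPolynomial.aeval_eq_eval] using hp x trivial
  · intro h
    rw [zariskiClosure, h, MvPolynomial.zeroLocus_bot, Set.top_eq_univ]

/-- The coordinate subsets onto which an irreducible variety projects dominantly are the
independent sets of a matroid. -/
theorem exists_algebraicMatroid {m : ℕ} (V : Set (Fin m → ℂ)) (hV : IsIrreducibleVariety V) :
    ∃ M : Matroid (Fin m), Set.univ = M.E ∧
      ∀ E : Set (Fin m), M.Indep E ↔ zariskiClosure (E.domRestrict '' V) = Set.univ := by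
  have := hV.prime
  let A := MvPolynomial (Fin m) ℂ ⧸ MvPolynomial.vanishingIdeal ℂ V
  let x : Fin m → A := fun e => Ideal.Quotient.mk _ (MvPolynomial.X e)
  refine ⟨(AlgebraicIndependent.matroid ℂ A).comap x, ?_, fun E => ?_⟩
  · simp
  · rw [zariskiClosure_eq_univ_iff, Matroid.comap_indep_iff,
      AlgebraicIndependent.matroid_indep_iff]
    have h1 : AlgebraicIndependent ℂ (fun e : E => x e) ↔
        MvPolynomial.vanishingIdeal ℂ (E.domRestrict '' V) = ⊥ := by
      rw [algebraicIndependent_iff, eq_bot_iff]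
      have h2 : ∀ p : MvPolynomial E ℂ, MvPolynomial.aeval (fun e : E => x e) p = 0 ↔
          p ∈ MvPolynomial.vanishingIdeal ℂ (E.domRestrict '' V) := by
        intro p
        have h3 : MvPolynomial.aeval (fun e : E => x e) p =
            Ideal.Quotient.mkₐ ℂ (MvPolynomial.vanishingIdeal ℂ V)
              (MvPolynomial.rename Subtype.val p) := by
          rw [← AlgHom.comp_apply]
          congr 1
          refine MvPolynomial.algHom_ext fun e => ?_
          simp [x]
        rw [h3, Ideal.Quotient.mkₐ_eq_mk, Ideal.Quotient.eq_zero_iff_mem,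
          MvPolynomial.mem_vanishingIdeal_iff, MvPolynomial.mem_vanishingIdeal_iff,
          Set.forall_mem_image]
        refine forall₂_congr fun v _ => ?_
        rw [MvPolynomial.aeval_rename]
        rfl
      exact ⟨fun h p hp => h p ((h2 p).2 hp), fun h p hp => h ((h2 p).1 hp)⟩
    rw [← h1]
    constructor
    · rintro ⟨h, hinj⟩
      exact (algebraicIndependent_image hinj).2 h
    · intro h
      have hinj : Set.InjOn x E := Set.injOn_iff_injective.2 h.injective
      exact ⟨(algebraicIndependent_image hinj).1 h, hinj⟩

/-- The algebraic matroid of an irreducible variety `V ⊆ ℂ^m`: a set `E` of coordinates is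
independent iff the Zariski closure of the projection of `V` to `ℂ^E` is all of `ℂ^E`. -/
def algebraicMatroid {m : ℕ} (V : Set (Fin m → ℂ)) (hV : IsIrreducibleVariety V) :
    Matroid (Fin m) :=
  Matroid.ofExistsMatroid Set.univ (fun E => zariskiClosure (E.domRestrict '' V) = Set.univ)
    (exists_algebraicMatroid V hV)

theorem algebraicMatroid_indep_iff {m : ℕ} (V : Set (Fin m → ℂ)) (hV : IsIrreducibleVariety V)
    (E : Set (Fin m)) :
    (algebraicMatroid V hV).Indep E ↔ zariskiClosure (E.domRestrict '' V) = Set.univ :=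
  Iff.rfl

/-- The Hadamard product of two varieties: the Zariski closure of the set of
coordinatewise products. -/
def hadamardProduct {m : ℕ} (V W : Set (Fin m → ℂ)) : Set (Fin m → ℂ) :=
  zariskiClosure {z | ∃ x ∈ V, ∃ y ∈ W, z = fun j => x j * y j}

/-- The Hadamard product of two linear spaces is irreducible. -/
theorem hadamardProduct_irreducible {m : ℕ} (L₁ L₂ : Submodule ℂ (Fin m → ℂ)) :
    IsIrreducibleVariety (hadamardProduct (L₁ : Set (Fin m → ℂ)) (L₂ : Set (Fin m → ℂ))) := by
  constructor
  · unfold hadamardProduct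
    rw [zariskiClosure, vanishingIdeal_zariskiClosure]
    rfl
  · rw [hadamardProduct, vanishingIdeal_zariskiClosure]
    refine ⟨?_, ?_⟩
    · rw [Ne, Ideal.eq_top_iff_one]
      intro h
      have := h (fun j => (0 : Fin m → ℂ) j * (0 : Fin m → ℂ) j)
        ⟨0, L₁.zero_mem, 0, L₂.zero_mem, rfl⟩
      simp at this
    · intro p q hpq
      by_contra! hcon
      obtain ⟨hp, hq⟩ := hcon
      rw [MvPolynomial.mem_vanishingIdeal_iff] at hp hq
      push Not at hp hq
      obtain ⟨_, ⟨x, hx, y, hy, rfl⟩, hp⟩ := hp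
      obtain ⟨_, ⟨x', hx', y', hy', rfl⟩, hq⟩ := hq
      let g : Fin m → Polynomial ℂ := fun j =>
        (Polynomial.C (x j) + Polynomial.X * Polynomial.C (x' j - x j)) *
          (Polynomial.C (y j) + Polynomial.X * Polynomial.C (y' j - y j))
      have hg : ∀ (r : MvPolynomial (Fin m) ℂ) (t : ℂ),
          (MvPolynomial.aeval g r).eval t =
            MvPolynomial.aeval (fun j => (x + t • (x' - x)) j * (y + t • (y' - y)) j) r := by
        intro r t
        have := MvPolynomial.comp_aeval_apply g (Polynomial.aeval t) r
        rw [Polynomial.coe_aeval_eq_eval] at this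
        rw [this]
        congr 2
        funext j
        simp [g]
      have hprod : MvPolynomial.aeval g p * MvPolynomial.aeval g q = 0 := by
        rw [← map_mul]
        refine Polynomial.funext fun t => ?_
        rw [hg, Polynomial.eval_zero]
        exact hpq _ ⟨_, L₁.add_mem hx (L₁.smul_mem t (L₁.sub_mem hx' hx)), _,
          L₂.add_mem hy (L₂.smul_mem t (L₂.sub_mem hy' hy)), rfl⟩
      rcases mul_eq_zero.1 hprod with h | h
      · refine hp ?_
        have := hg p 0
        rw [h] at this
        simpa using this.symm
      · refine hq ?_
        have := hg q 1
        rw [h] at this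
        simpa using this.symm

/-! ### Linear matroids -/

/-- The coordinate hyperplane `{x | x e = 0}` of `ℂ^m`. -/
def coordinateHyperplane {m : ℕ} (e : Fin m) : Submodule ℂ (Fin m → ℂ) :=
  LinearMap.ker (LinearMap.proj e)

/-- The coordinate function `x ↦ x e` restricted to `L`. With respect to a basis of `L`, it is
the row with index `e` of the matrix whose columns are the basis vectors. -/
def coordinateForm {m : ℕ} (L : Submodule ℂ (Fin m → ℂ)) (e : Fin m) : Module.Dual ℂ L :=
  (LinearMap.proj e : (Fin m → ℂ) →ₗ[ℂ] ℂ).domRestrict L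

/-- The rank function of the linear matroid of `L`, that is of the matroid on the coordinates
that is represented by the vectors `coordinateForm L e`: the dimension of their span. -/
noncomputable def linearRank {m : ℕ} (L : Submodule ℂ (Fin m → ℂ)) (F : Finset (Fin m)) : ℕ :=
  Module.finrank ℂ (Submodule.span ℂ (coordinateForm L '' (F : Set (Fin m))))

theorem isMonotoneSubmodular_rank_add_rank_sub_one {m : ℕ} (L₁ L₂ : Submodule ℂ (Fin m → ℂ)) :
    IsMonotoneSubmodular (fun F => (linearRank L₁ F : ℤ) + (linearRank L₂ F : ℤ) - 1) := by
  have hmono : ∀ (L : Submodule ℂ (Fin m → ℂ)) (X Y : Finset (Fin m)), X ⊆ Y →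
      linearRank L X ≤ linearRank L Y := fun L X Y h =>
    Submodule.finrank_mono (Submodule.span_mono (Set.image_mono (Finset.coe_subset.2 h)))
  have hsub : ∀ (L : Submodule ℂ (Fin m → ℂ)) (X Y : Finset (Fin m)),
      linearRank L (X ∪ Y) + linearRank L (X ∩ Y) ≤ linearRank L X + linearRank L Y := by
    intro L X Y
    unfold linearRank
    rw [← Submodule.finrank_sup_add_finrank_inf_eq
      (Submodule.span ℂ (coordinateForm L '' (X : Set (Fin m)))), Finset.coe_union, Set.image_union,
      Submodule.span_union]
    refine Nat.add_le_add_left ?_ _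
    exact Submodule.finrank_mono (le_inf (Submodule.span_mono (Set.image_mono (by simp)))
      (Submodule.span_mono (Set.image_mono (by simp))))
  refine ⟨fun X Y h => ?_, fun X Y => ?_⟩
  · have h1 := hmono L₁ X Y h
    have h2 := hmono L₂ X Y h
    omega
  · have h1 := hsub L₁ X Y
    have h2 := hsub L₂ X Y
    omega

/-! Let `x` and `y` be generic points of the two spaces, in disjoint sets of variables. The
algebraic matroid of the Hadamard product is that of the products `x e * y e`, and
`algebraicMatroid_hadamardProduct_indep_iff` shows that `F` is independent exactly when `#I + 1 ≤ r₁
I + r₂ I` for every nonempty `I ⊆ F`. This is also independence in the matroid induced by `r₁ + r₂ -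
1`.

Necessity is a dimension count. The products do not change when `x` is scaled by `t` and `y` by
`t⁻¹`, so one of the `r₁ I + r₂ I` parameters is lost
(`card_add_one_le_of_algebraicIndependent_mul`). Sufficiency uses the Jacobian criterion
(`algebraicIndependent_of_derivations`): the counting condition forces the differentials of the
products to be linearly independent (`forall_eq_zero_of_hadamard_relations`).

The rank formula is combinatorial. For a maximal independent `A ⊆ F`, the maximal tight subsets of
`A` are disjoint and absorb all of `F`, which yields a partition of `F` of total value at most `#A`.
-/

/-! ### The rank function of the induced matroid. -/

/-- A labelling `c` of the elements of `F` bounds the Dilworth truncation, through the partition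
of `F` into the nonempty classes of elements with a common label. -/
theorem dilworthTruncation_le_sum_of_labelling {m : ℕ} {κ : Type*} [DecidableEq κ]
    (f : Finset (Fin m) → ℤ) (F : Finset (Fin m)) (D : Finset κ) (c : Fin m → κ)
    (hc : ∀ b ∈ F, c b ∈ D) (g : κ → ℤ) (hg : ∀ d ∈ D, 0 ≤ g d)
    (hfg : ∀ d ∈ D, (F.filter fun b => c b = d).Nonempty → f (F.filter fun b => c b = d) ≤ g d) :
    dilworthTruncation f F ≤ ∑ d ∈ D, g d := by
  classical
  let D' := F.image c
  have hD' : D' ⊆ D := Finset.image_subset_iff.2 hc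
  let P : Finpartition F := Finpartition.ofExistsUnique
    (D'.image fun d => F.filter fun b => c b = d)
    (by simp)
    (by
      intro a ha
      refine ⟨F.filter fun b => c b = c a, ⟨?_, by simp [ha]⟩, ?_⟩
      · exact Finset.mem_image_of_mem _ (Finset.mem_image_of_mem _ ha)
      · rintro t ⟨ht, hat⟩
        obtain ⟨d, -, rfl⟩ := Finset.mem_image.1 ht
        rw [(Finset.mem_filter.1 hat).2])
    (by
      intro h
      obtain ⟨d, hd, h⟩ := Finset.mem_image.1 h
      obtain ⟨b, hb, rfl⟩ := Finset.mem_image.1 hd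
      exact Finset.notMem_empty b (h ▸ Finset.mem_filter.2 ⟨hb, rfl⟩))
  have hne : ∀ d ∈ D', (F.filter fun b => c b = d).Nonempty := by
    intro d hd
    obtain ⟨b, hb, rfl⟩ := Finset.mem_image.1 hd
    exact ⟨b, Finset.mem_filter.2 ⟨hb, rfl⟩⟩
  refine (Finset.inf'_le _ (Finset.mem_univ P)).trans ?_
  change ∑ p ∈ D'.image (fun d => F.filter fun b => c b = d), f p ≤ _
  -- Labels with empty class are dropped, which costs nothing because `g` is nonnegative; the
  -- remaining labels have nonempty, hence distinct, classes.
  rw [Finset.sum_image]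
  · exact (Finset.sum_le_sum fun d hd => hfg d (hD' hd) (hne d hd)).trans
      (Finset.sum_le_sum_of_subset_of_nonneg hD' fun d hd _ => hg d hd)
  · intro d hd d' _ h
    obtain ⟨b, hb⟩ := hne d hd
    have hb' : b ∈ F.filter fun b => c b = d' := by
      simpa [← h] using hb
    rw [← (Finset.mem_filter.1 hb).2, (Finset.mem_filter.1 hb').2]

/-- Any partition of `F` cuts `A` into pieces `A ∩ p`, each of size at most `f (A ∩ p) ≤ f p`.
Nonnegativity of `f` takes care of the parts that miss `A`. -/
theorem card_le_dilworthTruncation_of_subset {m : ℕ} {f : Finset (Fin m) → ℤ}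
    (hf : IsMonotoneSubmodular f) (hf0 : ∀ I, I.Nonempty → 0 ≤ f I) {A F : Finset (Fin m)}
    (hAF : A ⊆ F) (hA : ∀ I ⊆ A, I.Nonempty → (#I : ℤ) ≤ f I) :
    (#A : ℤ) ≤ dilworthTruncation f F := by
  classical
  refine Finset.le_inf' _ _ fun P _ => ?_
  have h1 : A = P.parts.biUnion fun p => A ∩ p := by
    rw [← Finset.inter_biUnion]
    have := P.biUnion_parts
    exact (Finset.inter_eq_left.2 (hAF.trans_eq this.symm)).symm
  have h2 : #A ≤ ∑ p ∈ P.parts, #(A ∩ p) := by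
    conv_lhs => rw [h1]
    exact Finset.card_biUnion_le
  refine (Int.ofNat_le.2 h2).trans ?_
  push_cast
  refine Finset.sum_le_sum fun p hp => ?_
  rcases (A ∩ p).eq_empty_or_nonempty with h | h
  · rw [h]
    simpa using hf0 p (P.nonempty_of_mem_parts hp)
  · exact (hA _ Finset.inter_subset_left h).trans (hf.mono _ _ Finset.inter_subset_right)

/-- If `f` takes the value one on singletons and `A` is a maximal independent subset of `F`,
then the Dilworth truncation of `F` is at most the size of `A`. -/
theorem IsMonotoneSubmodular.dilworthTruncation_le_card {m : ℕ} {f : Finset (Fin m) → ℤ}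
    (hf : IsMonotoneSubmodular f) (hf1 : ∀ e, f {e} = 1) {A F : Finset (Fin m)}
    (hA : ∀ I ⊆ A, I.Nonempty → (#I : ℤ) ≤ f I)
    (hmax : ∀ b ∈ F, b ∉ A → ∃ I ⊆ insert b A, I.Nonempty ∧ f I < #I) :
    dilworthTruncation f F ≤ #A := by
  classical
  let Tight : Finset (Fin m) → Prop := fun T => T ⊆ A ∧ T.Nonempty ∧ f T ≤ #T
  have hunion : ∀ T U, Tight T → Tight U → (T ∩ U).Nonempty → Tight (T ∪ U) := by
    rintro T U ⟨hTA, hT, hfT⟩ ⟨hUA, hU, hfU⟩ hTU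
    refine ⟨Finset.union_subset hTA hUA, hT.mono Finset.subset_union_left, ?_⟩
    have h1 := hf.submodular T U
    have h2 := hA (T ∩ U) (Finset.inter_subset_left.trans hTA) hTU
    have h3 := Finset.card_union_add_card_inter T U
    omega
  have hstep : ∀ b ∈ F, ∃ T, Tight T ∧ f (insert b T) ≤ #T := by
    intro b hb
    by_cases hbA : b ∈ A
    -- An element of `A` is covered by its own singleton, which is tight because `f {b} = 1`.
    · exact ⟨{b}, ⟨by simpa using hbA, by simp, by simp [hf1]⟩, by simp [hf1]⟩
    obtain ⟨I, hI, hIne, hlt⟩ := hmax b hb hbA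
    have hbI : b ∈ I := by
      by_contra hbI
      have := hA I ((Finset.subset_insert_iff_of_notMem hbI).1 hI) hIne
      omega
    have h1 : (1 : ℤ) ≤ f I := hf1 b ▸ hf.mono {b} I (by simpa using hbI)
    have hcard := Finset.card_erase_add_one hbI
    -- Removing `b` from a violating set `I` leaves a tight set: `f (I.erase b) ≤ f I ≤ #I - 1`. It
    -- is nonempty since `1 ≤ f I < #I`.
    refine ⟨I.erase b, ⟨Finset.subset_insert_iff.1 hI, ?_, ?_⟩, ?_⟩
    · rw [← Finset.card_pos]; omega
    · have := hf.mono _ _ (Finset.erase_subset b I)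
      omega
    · rw [Finset.insert_erase hbI]; omega
  let D : Finset (Finset (Fin m)) :=
    A.powerset.filter fun T => Tight T ∧ ∀ U, Tight U → T ⊆ U → U = T
  have hDmem : ∀ T, Tight T → ∃ U ∈ D, T ⊆ U := by
    intro T hT
    obtain ⟨U, hTU, hU⟩ := Finset.exists_le_maximal (A.powerset.filter Tight)
      (a := T) (by simp [hT, hT.1])
    have hU1 : Tight U := (Finset.mem_filter.1 hU.1).2
    refine ⟨U, ?_, hTU⟩
    refine Finset.mem_filter.2 ⟨Finset.mem_powerset.2 hU1.1, hU1, fun W hW hUW => ?_⟩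
    exact le_antisymm (hU.2 (Finset.mem_filter.2 ⟨Finset.mem_powerset.2 hW.1, hW⟩) hUW) hUW
  have hDT : ∀ U ∈ D, Tight U := fun U hU => (Finset.mem_filter.1 hU).2.1
  have hdisj : ∀ U ∈ D, ∀ W ∈ D, U ≠ W → Disjoint U W := by
    intro U hU W hW hne
    rw [Finset.disjoint_iff_inter_eq_empty]
    by_contra h
    have ht := hunion U W (hDT U hU) (hDT W hW) (Finset.nonempty_iff_ne_empty.2 h)
    have e1 := (Finset.mem_filter.1 hU).2.2 _ ht Finset.subset_union_left
    have e2 := (Finset.mem_filter.1 hW).2.2 _ ht Finset.subset_union_right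
    exact hne (e1.symm.trans e2)
  have hcover : ∀ b ∈ F, ∃ U ∈ D, f (insert b U) ≤ #U := by
    intro b hb
    obtain ⟨T, hT, hbT⟩ := hstep b hb
    obtain ⟨U, hU, hTU⟩ := hDmem T hT
    refine ⟨U, hU, ?_⟩
    obtain ⟨hUA, hUne, hfU⟩ := hDT U hU
    -- Absorption passes from `T` to a larger tight `U`: `f (insert b U) + f T ≤ f (insert b T) + f
    -- U ≤ #T + #U`, while `#T ≤ f T`.
    have h1 := hf.submodular (insert b T) U
    have h2 : insert b T ∪ U = insert b U := by
      rw [Finset.insert_union, Finset.union_eq_right.2 hTU]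
    have h3 : f T ≤ f (insert b T ∩ U) := hf.mono _ _
      (Finset.subset_inter (Finset.subset_insert _ _) hTU)
    have h4 := hA T hT.1 hT.2.1
    rw [h2] at h1
    omega
  -- Elements that are absorbed one at a time are absorbed together, by submodularity over `U` and
  -- `#U ≤ f U`.
  have habsorb : ∀ U ∈ D, ∀ S : Finset (Fin m), (∀ b ∈ S, f (insert b U) ≤ #U) →
      f (U ∪ S) ≤ #U := by
    intro U hU S
    obtain ⟨hUA, hUne, hfU⟩ := hDT U hU
    induction S using Finset.induction_on with
    | empty => intro _; simpa using hfU
    | insert b S hb ih =>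
      intro hS
      have h1 := ih fun a ha => hS a (Finset.mem_insert_of_mem ha)
      have h2 := hS b (Finset.mem_insert_self b S)
      have h3 := hf.submodular (U ∪ S) (insert b U)
      have h4 : U ∪ S ∪ insert b U = U ∪ insert b S := by
        ext x; simp; tauto
      have h5 : f U ≤ f ((U ∪ S) ∩ insert b U) := hf.mono _ _
        (Finset.subset_inter Finset.subset_union_left (Finset.subset_insert _ _))
      have h6 := hA U hUA hUne
      rw [h4] at h3
      omega
  choose! c hcD hcf using hcover
  refine (dilworthTruncation_le_sum_of_labelling f F D c hcD (fun U => (#U : ℤ))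
    (fun _ _ => by positivity) fun U hU _ => ?_).trans ?_
  · refine (hf.mono _ _ Finset.subset_union_right).trans (habsorb U hU _ fun b hb => ?_)
    obtain ⟨hbF, rfl⟩ := Finset.mem_filter.1 hb
    exact hcf b hbF
  · have h1 : ∑ U ∈ D, #U = #(D.biUnion id) :=
      (Finset.card_biUnion fun U hU W hW => hdisj U hU W hW).symm
    have h2 : #(D.biUnion id) ≤ #A :=
      Finset.card_le_card (Finset.biUnion_subset.2 fun U hU => (hDT U hU).1)
    exact_mod_cast h1.trans_le h2

/-- A basis of `F` bounds the truncation from below because it is independent and from above because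
it is maximal. -/
theorem toNat_eRk_inducedMatroid {m : ℕ} {f : Finset (Fin m) → ℤ}
    (hf : IsMonotoneSubmodular f) (hf1 : ∀ e, f {e} = 1) (F : Finset (Fin m)) :
    ((((inducedMatroid f hf).eRk (F : Set (Fin m))).toNat : ℕ) : ℤ) = dilworthTruncation f F := by
  classical
  have hindep : ∀ A : Finset (Fin m), (inducedMatroid f hf).Indep (A : Set (Fin m)) ↔
      ∀ I ⊆ A, I.Nonempty → (#I : ℤ) ≤ f I := fun A => by
    rw [inducedMatroid_indep_iff, card_le_dilworthTruncation_iff]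
  have hf0 : ∀ I : Finset (Fin m), I.Nonempty → 0 ≤ f I := by
    rintro I ⟨e, he⟩
    have := hf.mono {e} I (by simpa using he)
    rw [hf1] at this
    omega
  obtain ⟨B, hB⟩ := (inducedMatroid f hf).exists_isBasis' (F : Set (Fin m))
  obtain ⟨A, rfl⟩ : ∃ A : Finset (Fin m), (A : Set (Fin m)) = B :=
    ⟨B.toFinite.toFinset, by simp⟩
  have hAF : A ⊆ F := Finset.coe_subset.1 hB.subset
  have hA := (hindep A).1 hB.indep
  rw [hB.eRk_eq_encard, Set.encard_coe_eq_coe_finsetCard, ENat.toNat_natCast]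
  refine le_antisymm (card_le_dilworthTruncation_of_subset hf hf0 hAF hA)
    (hf.dilworthTruncation_le_card hf1 hA fun b hb hbA => ?_)
  by_contra! hcon
  have h1 := (hindep (insert b A)).2 hcon
  rw [Finset.coe_insert] at h1
  exact hbA (hB.mem_of_insert_indep hb h1)

/-! ### The Jacobian criterion. -/

theorem Derivation.apply_mvPolynomial_aeval {k R ι : Type*} [CommRing k] [CommRing R] [Algebra k R]
    [Fintype ι] (D : Derivation k R R) (φ : ι → R) (p : MvPolynomial ι k) :
    D (MvPolynomial.aeval φ p) =
      ∑ e, MvPolynomial.aeval φ (MvPolynomial.pderiv e p) * D (φ e) := by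
  classical
  induction p using MvPolynomial.induction_on with
  | C a => simp
  | add p q hp hq => simp [hp, hq, add_mul, Finset.sum_add_distrib]
  | mul_X p i hp =>
    simp only [map_mul, MvPolynomial.aeval_X, Derivation.leibniz, hp, smul_eq_mul,
      MvPolynomial.pderiv_X, map_add, add_mul, Finset.sum_add_distrib, Finset.mul_sum]
    have h1 : ∑ e, MvPolynomial.aeval φ p * MvPolynomial.aeval φ
        (Pi.single (M := fun _ => MvPolynomial ι k) e 1 i) * D (φ e) =
        MvPolynomial.aeval φ p * D (φ i) := by
      rw [Finset.sum_eq_single_of_mem i (Finset.mem_univ i) fun e _ he => by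
        rw [Pi.single_eq_of_ne he.symm, map_zero, mul_zero, zero_mul]]
      simp
    rw [h1]
    congr 1
    exact Finset.sum_congr rfl fun e _ => by ring

/-- The Jacobian criterion: if no nontrivial combination of the differentials of the `φ e` is
annihilated by a set of derivations, then the `φ e` are algebraically independent. -/
theorem algebraicIndependent_of_derivations {k R ι : Type*} [Field k] [CharZero k] [CommRing R]
    [Nontrivial R] [Algebra k R] [Fintype ι] (φ : ι → R) (S : Set (Derivation k R R))
    (h : ∀ q : ι → R, (∀ D ∈ S, ∑ e, q e * D (φ e) = 0) → ∀ e, q e = 0) :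
    AlgebraicIndependent k φ := by
  classical
  rw [algebraicIndependent_iff]
  suffices H : ∀ (n : ℕ) (p : MvPolynomial ι k), (∀ s, p.coeff s ≠ 0 → s.degree ≤ n) →
      MvPolynomial.aeval φ p = 0 → p = 0 by
    intro p hp
    refine H (p.support.sup Finsupp.degree) p (fun s hs => ?_) hp
    exact Finset.le_sup (f := Finsupp.degree) (MvPolynomial.mem_support_iff.2 hs)
  have key : ∀ p : MvPolynomial ι k, (∀ s, s ≠ 0 → p.coeff s = 0) →
      MvPolynomial.aeval φ p = 0 → p = 0 := by
    intro p hp h0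
    have hpC : p = MvPolynomial.C (p.coeff 0) := by
      ext s
      rw [MvPolynomial.coeff_C]
      split_ifs with hs
      · rw [hs]
      · exact hp s (Ne.symm hs)
    rw [hpC, MvPolynomial.aeval_C, map_eq_zero_iff _ (algebraMap k R).injective] at h0
    rw [hpC, h0, map_zero]
  intro n
  induction n with
  | zero =>
    intro p hp
    refine key p fun s hs => ?_
    by_contra hne
    exact hs ((Finsupp.degree_eq_zero_iff s).1 (Nat.le_zero.1 (hp s hne)))
  | succ n ih =>
    intro p hp h0
    -- By the chain rule the values `∂p/∂X_e (φ)` are the coefficients of a relation among the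
    -- differentials, so they vanish; the partial derivatives are then polynomial relations of lower
    -- degree.
    have hder : ∀ e, MvPolynomial.pderiv e p = 0 := by
      intro e
      refine ih _ (fun s hs => ?_) (h (fun e => MvPolynomial.aeval φ (MvPolynomial.pderiv e p))
        (fun D _ => ?_) e)
      · rw [MvPolynomial.coeff_pderiv] at hs
        have := hp _ (left_ne_zero_of_mul hs)
        rw [map_add, Finsupp.degree_single] at this
        omega
      · rw [← D.apply_mvPolynomial_aeval, h0, map_zero]
    -- In characteristic zero, vanishing partial derivatives force `p` to be constant.
    refine key p (fun s hs => ?_) h0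
    obtain ⟨e, he⟩ := Finsupp.ne_iff.1 hs
    have hle : Finsupp.single e 1 ≤ s := by
      rw [Finsupp.single_le_iff]
      exact Nat.one_le_iff_ne_zero.2 he
    have h1 := congrArg (MvPolynomial.coeff (s - Finsupp.single e 1)) (hder e)
    rw [MvPolynomial.coeff_pderiv, tsub_add_cancel_of_le hle, MvPolynomial.coeff_zero] at h1
    exact (mul_eq_zero.1 h1).resolve_right (Nat.cast_add_one_ne_zero _)

/-! ### Linear relations among the differentials of the products. -/

/-- The restriction of `L` to the coordinates in `F`. -/
def coordinateRestriction {m : ℕ} (L : Submodule ℂ (Fin m → ℂ)) (F : Finset (Fin m)) :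
    L →ₗ[ℂ] (F → ℂ) :=
  LinearMap.pi fun e => coordinateForm L e

/-- The coordinate forms span the range of the transpose of the restriction map, and a map and its
transpose have the same rank. -/
theorem linearRank_eq_finrank_range {m : ℕ} (L : Submodule ℂ (Fin m → ℂ)) (F : Finset (Fin m)) :
    linearRank L F = Module.finrank ℂ (LinearMap.range (coordinateRestriction L F)) := by
  classical
  have hg : ∀ e : F, (coordinateRestriction L F).dualMap ((Pi.basisFun ℂ F).dualBasis e) =
      coordinateForm L e := by
    intro e
    ext v
    simp [coordinateRestriction]
  have h : Submodule.span ℂ (coordinateForm L '' (F : Set (Fin m))) =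
      LinearMap.range (coordinateRestriction L F).dualMap := by
    rw [← Submodule.map_top, ← (Pi.basisFun ℂ F).dualBasis.span_eq, Submodule.map_span,
      ← Set.range_comp, Set.image_eq_range]
    congr 2
    funext e
    exact (hg e).symm
  rw [← LinearMap.finrank_range_dualMap_eq_finrank_range, linearRank, h]

theorem exists_linearIndependent_coordinateRestriction {m : ℕ} (L : Submodule ℂ (Fin m → ℂ))
    (F : Finset (Fin m)) :
    ∃ w : Fin (linearRank L F) → L,
      LinearIndependent ℂ fun j => coordinateRestriction L F (w j) := by
  rw [linearRank_eq_finrank_range]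
  let b := Module.finBasis ℂ (LinearMap.range (coordinateRestriction L F))
  choose w hw using fun j => (b j).2
  refine ⟨w, ?_⟩
  simp only [hw]
  exact b.linearIndependent.map' (Submodule.subtype _) (Submodule.ker_subtype _)

/-- Linearly independent vectors over a field stay independent after extension of scalars. -/
theorem eq_zero_of_sum_mul_algebraMap_eq_zero {k R ι σ : Type*} [Field k] [CommRing R]
    [Algebra k R] [Fintype ι] {w : ι → σ → k} (hw : LinearIndependent k w) (u : ι → R)
    (h : ∀ e, ∑ j, u j * algebraMap k R (w j e) = 0) (j : ι) : u j = 0 := by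
  -- The `k`-linear functionals on `R` separate its elements, so the relation can be tested over
  -- `k`.
  rw [← Module.forall_dual_apply_eq_zero_iff k]
  intro ψ
  refine Fintype.linearIndependent_iff.1 hw (fun j => ψ (u j)) ?_ j
  funext e
  have := congrArg ψ (h e)
  simp only [map_sum, mul_comm (u _), ← Algebra.smul_def, map_smul, map_zero] at this
  simpa [mul_comm] using this

/-- Let `x`, `y` be generic points of `L₁`, `L₂`. If `#I < r₁ I + r₂ I` for all nonempty `I ⊆ E`,
then the differentials of the products `x e * y e`, `e ∈ E`, are linearly independent. This is
Lovász's theorem on intersections with a generic hyperplane. The proof takes a minimal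
relation `q` and a vector tangent to the fibre of the product map but not to the scaling orbit,
differentiates the relation and pairs it with that vector, which gives a smaller relation. -/
theorem forall_eq_zero_of_hadamard_relations {m : ℕ} {R : Type*} [CommRing R] [IsDomain R]
    [Algebra ℂ R] (L₁ L₂ : Submodule ℂ (Fin m → ℂ)) (x y : Fin m → R)
    (hx : ∀ e, x e ≠ 0)
    (hD : ∀ v₁ ∈ L₁, ∀ v₂ ∈ L₂, ∃ D : Derivation ℂ R R,
      (∀ e, D (x e) = algebraMap ℂ R (v₁ e)) ∧ ∀ e, D (y e) = algebraMap ℂ R (v₂ e))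
    (E : Finset (Fin m))
    (hE : ∀ I ⊆ E, I.Nonempty → #I + 1 ≤ linearRank L₁ I + linearRank L₂ I)
    (q : Fin m → R)
    (hq₁ : ∀ w ∈ L₁, ∑ e ∈ E, q e * y e * algebraMap ℂ R (w e) = 0)
    (hq₂ : ∀ w ∈ L₂, ∑ e ∈ E, q e * x e * algebraMap ℂ R (w e) = 0) :
    ∀ e ∈ E, q e = 0 := by
  classical
  induction E using Finset.strongInduction generalizing q with
  | H E ih =>
  have ih' : ∀ e₀ ∈ E, ∀ q : Fin m → R, q e₀ = 0 →
      (∀ w ∈ L₁, ∑ e ∈ E, q e * y e * algebraMap ℂ R (w e) = 0) →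
      (∀ w ∈ L₂, ∑ e ∈ E, q e * x e * algebraMap ℂ R (w e) = 0) → ∀ e ∈ E, q e = 0 := by
    intro e₀ he₀ q hq0 hq₁ hq₂ e he
    by_cases hee : e = e₀
    · rw [hee, hq0]
    refine ih (E.erase e₀) (Finset.erase_ssubset he₀)
      (fun I hI => hE I (hI.trans (Finset.erase_subset _ _))) q (fun w hw => ?_)
      (fun w hw => ?_) e (Finset.mem_erase.2 ⟨hee, he⟩)
    · rw [Finset.sum_erase _ (by simp [hq0])]; exact hq₁ w hw
    · rw [Finset.sum_erase _ (by simp [hq0])]; exact hq₂ w hw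
  by_contra! hcon
  obtain ⟨e₀, he₀, hqe₀⟩ := hcon
  have hqne : ∀ e ∈ E, q e ≠ 0 := fun e he h0 => hqe₀ (ih' e he q h0 hq₁ hq₂ e₀ he₀)
  obtain ⟨w₁, hw₁⟩ := exists_linearIndependent_coordinateRestriction L₁ E
  obtain ⟨w₂, hw₂⟩ := exists_linearIndependent_coordinateRestriction L₂ E
  let X : (Fin (linearRank L₁ E) → R) →ₗ[R] (Fin m → R) :=
    ∑ j, (LinearMap.proj j).smulRight fun e => algebraMap ℂ R ((w₁ j : Fin m → ℂ) e)
  let Y : (Fin (linearRank L₂ E) → R) →ₗ[R] (Fin m → R) :=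
    ∑ j, (LinearMap.proj j).smulRight fun e => algebraMap ℂ R ((w₂ j : Fin m → ℂ) e)
  have hX : ∀ u e, X u e = ∑ j, u j * algebraMap ℂ R ((w₁ j : Fin m → ℂ) e) := by
    intro u e; simp [X]
  have hY : ∀ u e, Y u e = ∑ j, u j * algebraMap ℂ R ((w₂ j : Fin m → ℂ) e) := by
    intro u e; simp [Y]
  have hXinj : ∀ u, (∀ e ∈ E, X u e = 0) → u = 0 := by
    intro u hu
    funext j
    exact eq_zero_of_sum_mul_algebraMap_eq_zero hw₁ u
      (fun e => by rw [← hu e e.2, hX]; rfl) j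
  have hYinj : ∀ u, (∀ e ∈ E, Y u e = 0) → u = 0 := by
    intro u hu
    funext j
    exact eq_zero_of_sum_mul_algebraMap_eq_zero hw₂ u
      (fun e => by rw [← hu e e.2, hY]; rfl) j
  have hXlin : ∀ c : Fin m → R, (∀ w ∈ L₁, ∑ e ∈ E, c e * algebraMap ℂ R (w e) = 0) →
      ∀ u, ∑ e ∈ E, c e * X u e = 0 := by
    intro c hc u
    simp only [hX, Finset.mul_sum]
    rw [Finset.sum_comm]
    refine Finset.sum_eq_zero fun j _ => ?_
    rw [← mul_zero (u j), ← hc _ (w₁ j).2, Finset.mul_sum]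
    exact Finset.sum_congr rfl fun e _ => by ring
  have hYlin : ∀ c : Fin m → R, (∀ w ∈ L₂, ∑ e ∈ E, c e * algebraMap ℂ R (w e) = 0) →
      ∀ u, ∑ e ∈ E, c e * Y u e = 0 := by
    intro c hc u
    simp only [hY, Finset.mul_sum]
    rw [Finset.sum_comm]
    refine Finset.sum_eq_zero fun j _ => ?_
    rw [← mul_zero (u j), ← hc _ (w₂ j).2, Finset.mul_sum]
    exact Finset.sum_congr rfl fun e _ => by ring
  -- The tangency equation at `e₀` is replaced by `X u.1 e₀ = 0`, which excludes the scaling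
  -- direction `(x, -y)`. There are `#E` equations in at least `#E + 1` unknowns.
  obtain ⟨u, hune, hu⟩ : ∃ u : (Fin (linearRank L₁ E) → R) × (Fin (linearRank L₂ E) → R),
      u ≠ 0 ∧ ∀ e ∈ E, (if e = e₀ then X u.1 e else y e * X u.1 e + x e * Y u.2 e) = 0 := by
    let Φ : ((Fin (linearRank L₁ E) → R) × (Fin (linearRank L₂ E) → R)) →ₗ[R] (E → R) :=
      LinearMap.pi fun e => if (e : Fin m) = e₀ then LinearMap.proj (e : Fin m) ∘ₗ X ∘ₗ LinearMap.fst R _ _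
        else y e • (LinearMap.proj (e : Fin m) ∘ₗ X ∘ₗ LinearMap.fst R _ _) +
          x e • (LinearMap.proj (e : Fin m) ∘ₗ Y ∘ₗ LinearMap.snd R _ _)
    have hΦ : ¬ Function.Injective Φ := by
      intro hinj
      have h1 := LinearMap.finrank_le_finrank_of_injective hinj
      have h2 := hE E subset_rfl ⟨e₀, he₀⟩
      simp at h1
      omega
    rw [← LinearMap.ker_eq_bot, Submodule.eq_bot_iff] at hΦ
    push Not at hΦ
    obtain ⟨u, hu, hne⟩ := hΦ
    refine ⟨u, hne, fun e he => ?_⟩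
    have := congrFun (LinearMap.mem_ker.1 hu) ⟨e, he⟩
    simp only [Φ, LinearMap.pi_apply, Pi.zero_apply] at this
    split_ifs at this ⊢ <;> simpa using this
  have hX0 : X u.1 e₀ = 0 := by simpa using hu e₀ he₀
  have hne : ∀ e ∈ E, e ≠ e₀ → y e * X u.1 e + x e * Y u.2 e = 0 := fun e he h => by
    simpa [h] using hu e he
  have hsum : ∑ e ∈ E, q e * (y e * X u.1 e + x e * Y u.2 e) = 0 := by
    have h1 := hXlin _ hq₁ u.1
    have h2 := hYlin _ hq₂ u.2
    rw [← add_zero (0 : R)]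
    nth_rewrite 1 [← h1]
    rw [← h2, ← Finset.sum_add_distrib]
    exact Finset.sum_congr rfl fun e _ => by ring
  -- Pairing the relation `q` with the solution leaves only the term at `e₀`; as `q e₀ ≠ 0`, the
  -- omitted equation holds too.
  have htan : ∀ e ∈ E, y e * X u.1 e + x e * Y u.2 e = 0 := by
    intro e he
    by_cases h : e = e₀
    · rw [Finset.sum_eq_single_of_mem e he fun f hf hfe => by
        rw [hne f hf (h ▸ hfe), mul_zero]] at hsum
      exact (mul_eq_zero.1 hsum).resolve_left (hqne e he)
    · exact hne e he h
  have hder : ∀ v₁ ∈ L₁, ∀ v₂ ∈ L₂, ∑ e ∈ E, q e * (X u.1 e * algebraMap ℂ R (v₂ e) +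
      Y u.2 e * algebraMap ℂ R (v₁ e)) = 0 := by
    intro v₁ hv₁ v₂ hv₂
    obtain ⟨D, hDx, hDy⟩ := hD v₁ hv₁ v₂ hv₂
    have h1 := hXlin (fun e => D (q e * y e)) (fun w hw => by
      have := congrArg D (hq₁ w hw)
      simpa [mul_comm] using this) u.1
    have h2 := hYlin (fun e => D (q e * x e)) (fun w hw => by
      have := congrArg D (hq₂ w hw)
      simpa [mul_comm] using this) u.2
    rw [← add_zero (0 : R)]
    nth_rewrite 1 [← h1]
    rw [← h2, ← Finset.sum_add_distrib]
    refine Finset.sum_congr rfl fun e he => ?_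
    simp only [Derivation.leibniz, hDx, hDy, smul_eq_mul]
    -- The unknown derivatives `D (q e)` occur only as multiples of the tangency equation and drop
    -- out.
    linear_combination - D (q e) * htan e he
  have hd₂ : ∀ v ∈ L₂, ∑ e ∈ E, q e * X u.1 e * algebraMap ℂ R (v e) = 0 := by
    intro v hv
    simpa [mul_assoc] using hder 0 L₁.zero_mem v hv
  have hd₁ : ∀ v ∈ L₁, ∑ e ∈ E, q e * Y u.2 e * algebraMap ℂ R (v e) = 0 := by
    intro v hv
    simpa [mul_assoc] using hder v hv 0 L₂.zero_mem
  have hprod : ∀ e ∈ E, x e * ∏ f ∈ E.erase e, x f = ∏ f ∈ E, x f := fun e he =>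
    Finset.mul_prod_erase E x he
  -- The new relation is `q * X / x` with denominators cleared; it vanishes at `e₀`. On `L₁` it is a
  -- relation because tangency turns `y * X / x` into `-Y`.
  have hq' := ih' e₀ he₀ (fun e => q e * X u.1 e * ∏ f ∈ E.erase e, x f) (by simp [hX0])
    (fun w hw => by
      rw [← mul_zero (-∏ f ∈ E, x f), ← hd₁ w hw, Finset.mul_sum]
      refine Finset.sum_congr rfl fun e he => ?_
      rw [← hprod e he]
      linear_combination (q e * (∏ f ∈ E.erase e, x f) * algebraMap ℂ R (w e)) * htan e he)
    (fun w hw => by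
      rw [← mul_zero (∏ f ∈ E, x f), ← hd₂ w hw, Finset.mul_sum]
      refine Finset.sum_congr rfl fun e he => ?_
      rw [← hprod e he]
      ring)
  have hXz : ∀ e ∈ E, X u.1 e = 0 := fun e he => by
    have h1 := (mul_eq_zero.1 (hq' e he)).resolve_right (Finset.prod_ne_zero_iff.2 fun f _ => hx f)
    exact (mul_eq_zero.1 h1).resolve_left (hqne e he)
  have hYz : ∀ e ∈ E, Y u.2 e = 0 := fun e he => by
    have h1 := htan e he
    rw [hXz e he, mul_zero, zero_add] at h1
    exact (mul_eq_zero.1 h1).resolve_left (hx e)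
  exact hune (Prod.ext (hXinj _ hXz) (hYinj _ hYz))

/-! ### The upper bound from scaling. -/

/-- Write `x e * y e = (x e / x e₀) * (y e * x e₀)`. In a basis of the span of the `x e` that
contains `x e₀`, division turns `x e₀` into `1`, so one generator fewer suffices. -/
theorem card_add_one_le_of_algebraicIndependent_mul {k K ι : Type*} [Field k] [Field K]
    [Algebra k K] (x y : ι → K) (I : Finset ι) (hI : I.Nonempty) (hx : ∀ e ∈ I, x e ≠ 0)
    (h : AlgebraicIndependent k fun e : I => x e * y e) :
    #I + 1 ≤ Module.finrank k (Submodule.span k (x '' I)) +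
      Module.finrank k (Submodule.span k (y '' I)) := by
  classical
  obtain ⟨e₀, he₀⟩ := hI
  have hx₀ := hx e₀ he₀
  have hcard : ∀ t b : Set K, b ⊆ t → t ⊆ Submodule.span k b → LinearIndepOn k id b →
      t.Finite → b.encard = Module.finrank k (Submodule.span k t) := by
    intro t b hbt htb hb ht
    have : Fintype b := (ht.subset hbt).fintype
    have h1 : Submodule.span k t = Submodule.span k b :=
      le_antisymm (Submodule.span_le.2 htb) (Submodule.span_mono hbt)
    rw [h1, finrank_span_set_eq_card hb, Set.encard_eq_coe_toFinset_card]
  obtain ⟨b₁, hb₁I, heb₁, hspan₁, hli₁⟩ := exists_linearIndepOn_id_extension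
    (s := {x e₀}) (t := x '' I) (LinearIndepOn.singleton (R := k) (v := id) hx₀)
    (by simpa using Set.mem_image_of_mem x he₀)
  obtain ⟨b₂, hb₂I, -, hspan₂, hli₂⟩ := exists_linearIndepOn_id_extension
    (s := ∅) (t := y '' I) (linearIndepOn_empty k id) (Set.empty_subset _)
  have hc₁ := hcard _ _ hb₁I hspan₁ hli₁ (I.finite_toSet.image x)
  have hc₂ := hcard _ _ hb₂I hspan₂ hli₂ (I.finite_toSet.image y)
  let S : Set K := (fun z => z * (x e₀)⁻¹) '' (b₁ \ {x e₀}) ∪ (fun z => z * x e₀) '' b₂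
  have hS : S.encard + 1 ≤ b₁.encard + b₂.encard := by
    rw [← Set.encard_sdiff_singleton_add_one (heb₁ rfl), add_right_comm]
    gcongr
    exact (Set.encard_union_le _ _).trans
      (add_le_add (Set.encard_image_le _ _) (Set.encard_image_le _ _))
  have hadj₁ : ∀ z ∈ Submodule.span k b₁, z * (x e₀)⁻¹ ∈ Algebra.adjoin k S := by
    intro z hz
    have : Submodule.span k b₁ ≤
        (Subalgebra.toSubmodule (Algebra.adjoin k S)).comap (LinearMap.mulRight k (x e₀)⁻¹) := by
      refine Submodule.span_le.2 fun c hc => ?_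
      by_cases hce : c = x e₀
      · simp [hce, hx₀]
      · exact Algebra.subset_adjoin (Or.inl ⟨c, ⟨hc, hce⟩, rfl⟩)
    exact this hz
  have hadj₂ : ∀ z ∈ Submodule.span k b₂, z * x e₀ ∈ Algebra.adjoin k S := by
    intro z hz
    have : Submodule.span k b₂ ≤
        (Subalgebra.toSubmodule (Algebra.adjoin k S)).comap (LinearMap.mulRight k (x e₀)) :=
      Submodule.span_le.2 fun c hc => Algebra.subset_adjoin (Or.inr ⟨c, hc, rfl⟩)
    exact this hz
  let M := AlgebraicIndependent.matroid k K
  have hcl : Set.range (fun e : I => x e * y e) ⊆ M.closure S := by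
    rintro _ ⟨e, rfl⟩
    have h1 : x e * y e ∈ Algebra.adjoin k S := by
      have := Subalgebra.mul_mem _ (hadj₁ _ (hspan₁ (Set.mem_image_of_mem x e.2)))
        (hadj₂ _ (hspan₂ (Set.mem_image_of_mem y e.2)))
      convert! this using 1
      field_simp
    rw [AlgebraicIndependent.matroid_closure_eq]
    exact isAlgebraic_algebraMap (⟨_, h1⟩ : Algebra.adjoin k S)
  have hind : M.Indep (Set.range fun e : I => x e * y e) :=
    AlgebraicIndependent.matroid_indep_iff.2 h.coe_range
  have h1 := hind.encard_le_eRk_of_subset hcl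
  rw [M.eRk_closure_eq, ← Set.image_univ, h.injective.encard_image, Set.encard_univ,
    ENat.card_eq_coe_fintype_card, Fintype.card_coe] at h1
  have h2 := (add_le_add_left (h1.trans (M.eRk_le_encard S)) 1).trans hS
  rw [hc₁, hc₂] at h2
  exact_mod_cast h2

/-! ### Generic points and independence in the Hadamard product. -/

/-- Generic points of two linear spaces: the coordinates on `L₁` and `L₂` become linear forms in
independent sets of variables. They can be specialised to any pair of points, polynomials are
detected by these specialisations, and there is a derivation in each direction. -/
theorem exists_generic_points {m : ℕ} (L₁ L₂ : Submodule ℂ (Fin m → ℂ)) :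
    ∃ (Φ₁ : Module.Dual ℂ L₁ →ₗ[ℂ] MvPolynomial (Fin m ⊕ Fin m) ℂ)
      (Φ₂ : Module.Dual ℂ L₂ →ₗ[ℂ] MvPolynomial (Fin m ⊕ Fin m) ℂ),
      (∀ v₁ v₂, ∃ ε : MvPolynomial (Fin m ⊕ Fin m) ℂ →ₐ[ℂ] ℂ,
        (∀ a, ε (Φ₁ a) = a v₁) ∧ ∀ a, ε (Φ₂ a) = a v₂) ∧
      (∀ r ≠ 0, ∃ (ε : MvPolynomial (Fin m ⊕ Fin m) ℂ →ₐ[ℂ] ℂ) (v₁ : L₁) (v₂ : L₂),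
        ε r ≠ 0 ∧ (∀ a, ε (Φ₁ a) = a v₁) ∧ ∀ a, ε (Φ₂ a) = a v₂) ∧
      ∀ v₁ v₂, ∃ D : Derivation ℂ (MvPolynomial (Fin m ⊕ Fin m) ℂ)
        (MvPolynomial (Fin m ⊕ Fin m) ℂ),
        (∀ a, D (Φ₁ a) = algebraMap ℂ _ (a v₁)) ∧ ∀ a, D (Φ₂ a) = algebraMap ℂ _ (a v₂) := by
  obtain ⟨P₁, hP₁⟩ := L₁.subtype.exists_leftInverse_of_injective L₁.ker_subtype
  obtain ⟨P₂, hP₂⟩ := L₂.subtype.exists_leftInverse_of_injective L₂.ker_subtype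
  -- This is the form `a ∘ P₁` on `ℂ^m`, written as a linear polynomial, where `P₁` is a projection
  -- onto `L₁`.
  let Φ₁ : Module.Dual ℂ L₁ →ₗ[ℂ] MvPolynomial (Fin m ⊕ Fin m) ℂ :=
    ∑ i, (Module.Dual.eval ℂ L₁ (P₁ (Pi.single i 1))).smulRight (MvPolynomial.X (Sum.inl i))
  let Φ₂ : Module.Dual ℂ L₂ →ₗ[ℂ] MvPolynomial (Fin m ⊕ Fin m) ℂ :=
    ∑ i, (Module.Dual.eval ℂ L₂ (P₂ (Pi.single i 1))).smulRight (MvPolynomial.X (Sum.inr i))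
  have hsum : ∀ (L : Submodule ℂ (Fin m → ℂ)) (P : (Fin m → ℂ) →ₗ[ℂ] L) (a : Module.Dual ℂ L)
      (v : Fin m → ℂ), ∑ i, a (P (Pi.single i 1)) * v i = a (P v) := by
    intro L P a v
    conv_rhs => rw [pi_eq_sum_univ' v]
    simp [map_sum, mul_comm]
  have hev : ∀ v : Fin m ⊕ Fin m → ℂ,
      (∀ a, MvPolynomial.aeval v (Φ₁ a) = a (P₁ fun i => v (Sum.inl i))) ∧
      ∀ a, MvPolynomial.aeval v (Φ₂ a) = a (P₂ fun i => v (Sum.inr i)) := by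
    intro v
    refine ⟨fun a => ?_, fun a => ?_⟩
    · rw [← hsum]; simp [Φ₁]
    · rw [← hsum]; simp [Φ₂]
  have hp₁ : ∀ v : L₁, P₁ (fun i => (v : Fin m → ℂ) i) = v := fun v => LinearMap.congr_fun hP₁ v
  have hp₂ : ∀ v : L₂, P₂ (fun i => (v : Fin m → ℂ) i) = v := fun v => LinearMap.congr_fun hP₂ v
  refine ⟨Φ₁, Φ₂, fun v₁ v₂ => ?_, fun r hr => ?_, fun v₁ v₂ => ?_⟩
  · obtain ⟨h1, h2⟩ := hev (Sum.elim v₁ v₂)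
    refine ⟨_, fun a => (h1 a).trans ?_, fun a => (h2 a).trans ?_⟩
    · simp [hp₁]
    · simp [hp₂]
  · obtain ⟨v, hv⟩ : ∃ v, MvPolynomial.eval v r ≠ 0 := by
      by_contra! h
      exact hr (MvPolynomial.funext fun v => by rw [h, map_zero])
    exact ⟨MvPolynomial.aeval v, _, _, by rwa [MvPolynomial.aeval_eq_eval], hev v⟩
  -- The directional derivative along the constant vector `(v₁, v₂)`.
  · refine ⟨MvPolynomial.mkDerivation ℂ
      (Sum.elim (fun i => MvPolynomial.C ((v₁ : Fin m → ℂ) i))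
        fun i => MvPolynomial.C ((v₂ : Fin m → ℂ) i)), fun a => ?_, fun a => ?_⟩
    · conv_rhs => rw [← hp₁ v₁, ← hsum]
      simp [Φ₁, MvPolynomial.mkDerivation_X, MvPolynomial.smul_eq_C_mul,
        MvPolynomial.algebraMap_eq]
    · conv_rhs => rw [← hp₂ v₂, ← hsum]
      simp [Φ₂, MvPolynomial.mkDerivation_X, MvPolynomial.smul_eq_C_mul,
        MvPolynomial.algebraMap_eq]

/-- A polynomial vanishes on a projection exactly when its pullback vanishes on the set itself, and
closure does not change the vanishing ideal. -/
theorem vanishingIdeal_domRestrict_zariskiClosure {m : ℕ} (S : Set (Fin m → ℂ))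
    (E : Set (Fin m)) :
    MvPolynomial.vanishingIdeal ℂ (E.domRestrict '' zariskiClosure S) =
      MvPolynomial.vanishingIdeal ℂ (E.domRestrict '' S) := by
  have h : ∀ (T : Set (Fin m → ℂ)) (p : MvPolynomial E ℂ),
      p ∈ MvPolynomial.vanishingIdeal ℂ (E.domRestrict '' T) ↔
        MvPolynomial.rename Subtype.val p ∈ MvPolynomial.vanishingIdeal ℂ T := by
    intro T p
    rw [MvPolynomial.mem_vanishingIdeal_iff, MvPolynomial.mem_vanishingIdeal_iff,
      Set.forall_mem_image]
    refine forall₂_congr fun v _ => ?_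
    rw [MvPolynomial.aeval_rename]
    rfl
  ext p
  rw [h, h, vanishingIdeal_zariskiClosure]

theorem algebraicMatroid_hadamardProduct_indep_iff {m : ℕ} (L₁ L₂ : Submodule ℂ (Fin m → ℂ))
    (h₁ : ∀ e : Fin m, ¬ L₁ ≤ coordinateHyperplane e)
    (F : Finset (Fin m)) :
    (algebraicMatroid (hadamardProduct (L₁ : Set (Fin m → ℂ)) (L₂ : Set (Fin m → ℂ)))
      (hadamardProduct_irreducible L₁ L₂)).Indep (F : Set (Fin m)) ↔
      ∀ I ⊆ F, I.Nonempty → #I + 1 ≤ linearRank L₁ I + linearRank L₂ I := by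
  classical
  obtain ⟨Φ₁, Φ₂, hev, hsep, hder⟩ := exists_generic_points L₁ L₂
  set R := MvPolynomial (Fin m ⊕ Fin m) ℂ
  let x : Fin m → R := fun e => Φ₁ (coordinateForm L₁ e)
  let y : Fin m → R := fun e => Φ₂ (coordinateForm L₂ e)
  have hx : ∀ e, x e ≠ 0 := by
    intro e h0
    refine h₁ e fun v hv => ?_
    obtain ⟨ε, hε, -⟩ := hev ⟨v, hv⟩ 0
    have := hε (coordinateForm L₁ e)
    rw [show Φ₁ (coordinateForm L₁ e) = 0 from h0, map_zero] at this
    exact this.symm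
  have hindep : ∀ I : Finset (Fin m),
      (algebraicMatroid (hadamardProduct (L₁ : Set (Fin m → ℂ)) (L₂ : Set (Fin m → ℂ)))
        (hadamardProduct_irreducible L₁ L₂)).Indep (I : Set (Fin m)) ↔
        AlgebraicIndependent ℂ fun e : I => x e * y e := by
    intro I
    rw [algebraicMatroid_indep_iff, zariskiClosure_eq_univ_iff, hadamardProduct,
      vanishingIdeal_domRestrict_zariskiClosure, algebraicIndependent_iff, eq_bot_iff]
    have hε : ∀ (ε : R →ₐ[ℂ] ℂ) (v₁ : L₁) (v₂ : L₂), (∀ a, ε (Φ₁ a) = a v₁) →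
        (∀ a, ε (Φ₂ a) = a v₂) → ∀ p : MvPolynomial I ℂ,
        ε (MvPolynomial.aeval (fun e : I => x e * y e) p) =
          MvPolynomial.aeval ((I : Set (Fin m)).domRestrict
            fun j => (v₁ : Fin m → ℂ) j * (v₂ : Fin m → ℂ) j) p := by
      intro ε v₁ v₂ hε₁ hε₂ p
      rw [MvPolynomial.comp_aeval_apply]
      congr 2
      funext e
      simp only [x, y, map_mul, hε₁, hε₂]
      rfl
    have hmem : ∀ p : MvPolynomial I ℂ, MvPolynomial.aeval (fun e : I => x e * y e) p = 0 ↔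
        p ∈ MvPolynomial.vanishingIdeal ℂ ((I : Set (Fin m)).domRestrict ''
          {z | ∃ x ∈ (L₁ : Set (Fin m → ℂ)), ∃ y ∈ (L₂ : Set (Fin m → ℂ)),
            z = fun j => x j * y j}) := by
      intro p
      rw [MvPolynomial.mem_vanishingIdeal_iff, Set.forall_mem_image]
      constructor
      · rintro h _ ⟨v₁, hv₁, v₂, hv₂, rfl⟩
        obtain ⟨ε, hε₁, hε₂⟩ := hev ⟨v₁, hv₁⟩ ⟨v₂, hv₂⟩
        rw [← hε ε ⟨v₁, hv₁⟩ ⟨v₂, hv₂⟩ hε₁ hε₂, h, map_zero]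
      · intro h
        by_contra hne
        obtain ⟨ε, v₁, v₂, hne, hε₁, hε₂⟩ := hsep _ hne
        rw [hε ε v₁ v₂ hε₁ hε₂] at hne
        exact hne (h ⟨v₁, v₁.2, v₂, v₂.2, rfl⟩)
    exact ⟨fun h p hp => h ((hmem p).1 hp), fun h p hp => h p ((hmem p).2 hp)⟩
  have hxy : ∀ e, ∀ D : Derivation ℂ R R, D (x e * y e) = x e * D (y e) + y e * D (x e) := by
    intro e D
    simp [Derivation.leibniz]
  constructor
  · intro hF I hIF hI
    have hind := (hindep I).1 (hF.subset (Finset.coe_subset.2 hIF))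
    -- The scaling bound divides by a coordinate of `x`, hence the passage to the fraction field.
    let K := FractionRing R
    have hinj : Function.Injective (algebraMap R K) := IsFractionRing.injective R K
    have hrank : ∀ (L : Submodule ℂ (Fin m → ℂ)) (Φ : Module.Dual ℂ L →ₗ[ℂ] R),
        Module.finrank ℂ (Submodule.span ℂ
          ((fun e => algebraMap R K (Φ (coordinateForm L e))) '' (I : Set (Fin m)))) ≤
          linearRank L I := by
      intro L Φ
      have := Submodule.finrank_map_le ((IsScalarTower.toAlgHom ℂ R K).toLinearMap ∘ₗ Φ)
        (Submodule.span ℂ (coordinateForm L '' (I : Set (Fin m))))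
      rwa [Submodule.map_span, ← Set.image_comp] at this
    refine (card_add_one_le_of_algebraicIndependent_mul (k := ℂ) (fun e => algebraMap R K (x e))
      (fun e => algebraMap R K (y e)) I hI
      (fun e _ => (map_ne_zero_iff _ hinj).2 (hx e)) ?_).trans
      (add_le_add (hrank L₁ Φ₁) (hrank L₂ Φ₂))
    have := hind.map' (f := IsScalarTower.toAlgHom ℂ R K) hinj
    convert! this using 1
    funext e
    simp
  · intro hF
    rw [hindep]
    refine algebraicIndependent_of_derivations _ Set.univ fun q hq e => ?_
    let q' : Fin m → R := fun e => if h : e ∈ F then q ⟨e, h⟩ else 0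
    have hq' : ∀ g : Fin m → R, ∑ e ∈ F, q' e * g e = ∑ e : F, q e * g e := by
      intro g
      rw [← Finset.sum_coe_sort]
      exact Finset.sum_congr rfl fun e _ => by simp [q']
    have key := forall_eq_zero_of_hadamard_relations L₁ L₂ x y hx
      (fun v₁ hv₁ v₂ hv₂ => by
        obtain ⟨D, hD₁, hD₂⟩ := hder ⟨v₁, hv₁⟩ ⟨v₂, hv₂⟩
        exact ⟨D, fun e => hD₁ _, fun e => hD₂ _⟩) F hF q'
      (fun w hw => by
        -- Along `(w, 0)` the `y e` are constant, so `D (x e * y e) = y e * w e`.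
        obtain ⟨D, hD₁, hD₂⟩ := hder ⟨w, hw⟩ 0
        have h := hq D trivial
        simp only [mul_assoc]
        rw [hq', ← h]
        refine Finset.sum_congr rfl fun e _ => ?_
        rw [hxy, hD₁, hD₂, map_zero, map_zero, mul_zero, zero_add]
        rfl)
      (fun w hw => by
        obtain ⟨D, hD₁, hD₂⟩ := hder 0 ⟨w, hw⟩
        have h := hq D trivial
        simp only [mul_assoc]
        rw [hq', ← h]
        refine Finset.sum_congr rfl fun e _ => ?_
        rw [hxy, hD₁, hD₂, map_zero, map_zero, mul_zero, add_zero]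
        rfl) e e.2
    simpa [q'] using key

theorem linearRank_singleton {m : ℕ} (L : Submodule ℂ (Fin m → ℂ)) (e : Fin m)
    (h : ¬ L ≤ coordinateHyperplane e) : linearRank L {e} = 1 := by
  rw [linearRank, Finset.coe_singleton, Set.image_singleton]
  refine finrank_span_singleton fun h0 => h fun v hv => ?_
  exact LinearMap.congr_fun h0 ⟨v, hv⟩

theorem mainTheorem1 (m : ℕ) (L₁ L₂ : Submodule ℂ (Fin m → ℂ))
    (h₁ : ∀ e : Fin m, ¬ L₁ ≤ coordinateHyperplane e)
    (h₂ : ∀ e : Fin m, ¬ L₂ ≤ coordinateHyperplane e) :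
    algebraicMatroid (hadamardProduct (L₁ : Set (Fin m → ℂ)) (L₂ : Set (Fin m → ℂ)))
        (hadamardProduct_irreducible L₁ L₂) =
      inducedMatroid (fun F => (linearRank L₁ F : ℤ) + (linearRank L₂ F : ℤ) - 1)
        (isMonotoneSubmodular_rank_add_rank_sub_one L₁ L₂) ∧
    ∀ F : Finset (Fin m),
      (((algebraicMatroid (hadamardProduct (L₁ : Set (Fin m → ℂ)) (L₂ : Set (Fin m → ℂ)))
          (hadamardProduct_irreducible L₁ L₂)).eRk (F : Set (Fin m))).toNat : ℤ) =
        dilworthTruncation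
          (fun F => (linearRank L₁ F : ℤ) + (linearRank L₂ F : ℤ) - 1) F := by
  have heq : algebraicMatroid (hadamardProduct (L₁ : Set (Fin m → ℂ)) (L₂ : Set (Fin m → ℂ)))
        (hadamardProduct_irreducible L₁ L₂) =
      inducedMatroid (fun F => (linearRank L₁ F : ℤ) + (linearRank L₂ F : ℤ) - 1)
        (isMonotoneSubmodular_rank_add_rank_sub_one L₁ L₂) := by
    refine Matroid.ext_indep rfl fun E _ => ?_
    obtain ⟨F, rfl⟩ : ∃ F : Finset (Fin m), (F : Set (Fin m)) = E :=
      ⟨E.toFinite.toFinset, by simp⟩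
    rw [algebraicMatroid_hadamardProduct_indep_iff L₁ L₂ h₁, inducedMatroid_indep_iff,
      card_le_dilworthTruncation_iff]
    refine forall₃_congr fun I _ _ => ?_
    omega
  refine ⟨heq, fun F => ?_⟩
  rw [heq]
  -- Neither space lies in a coordinate hyperplane, so singletons have value `1 + 1 - 1 = 1`.
  refine toNat_eRk_inducedMatroid _ (fun e => ?_) F
  rw [linearRank_singleton L₁ e (h₁ e), linearRank_singleton L₂ e (h₂ e)]
  norm_num
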